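/- **Theorem (Confidence ellipsoid).** Let $p,d\ge 0$, let $\Sigma_p\in\mathbb{R}^{p\times p}$ be symmetric positive definite, and let $(\mathcal{F}_n)_{n\ge 0}$ be a filtration on a probability space. Let $(\eta_n)_{n\ge1}$ be an $\mathbb{R}^p$-valued noise process such that, for every $n\ge1$, $\eta_n$ is $\mathcal{F}_n$-measurable and conditionally $\Sigma_p$-sub-Gaussian given the past, i.e. for all $u\in\mathbb{R}^p$, $$\mathbb{E}\left[\exp(u^{\mathsf T}\eta_n)\,\middle|\,\mathcal{F}_{n-1}\right]\le \exp\left(\tfrac12 u^{\mathsf T}\Sigma_p u\right)\quad\text{almost surely}$$ (in particular this holds if $\eta_n$ is independent of $\mathcal{F}_{n-1}$ and $\mathbb{E}[\exp(u^{\mathsf T}\eta_n)]\le\exp(\frac12u^{\mathsf T}\Sigma_pu)$ for all $u$). Let $(\Phi_n)_{n\ge1}$ be a process of random feature matrices with values in $\mathbb{R}^{p\times d}$ such that $\Phi_n$ is $\mathcal{F}_{n-1}$-measurable. Let $\theta\in[-S,S]^d$ be a fixed parameter and let $y_n=\Phi_n\theta+\eta_n$ for $n\ge1$. For $\lambda>0$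 and $N\in\mathbb{N}$ let $$G_{N,\lambda}=\sum_{n=1}^N\Phi_n^{\mathsf T}\Sigma_p^{-1}\Phi_n+\lambda I_d,\qquad \theta_{N,\lambda}=G_{N,\lambda}^{-1}\sum_{n=1}^N\Phi_n^{\mathsf T}\Sigma_p^{-1}y_n$$ be the regularized Gram matrix and the regularized least-squares estimator (the unique minimizer over $\vartheta\in\mathbb{R}^d$ of $\sum_{n=1}^N\|y_n-\Phi_n\vartheta\|^2_{\Sigma_p^{-1}}+\lambda\|\vartheta\|_2^2$), where $\|x\|_M=(x^{\mathsf T}Mx)^{1/2}$. Then for every $\delta\in(0,1)$, every $\lambda>0$ and every $N\in\mathbb{N}$, with probability at least $1-\delta$, $$\|\theta_{N,\lambda}-\theta\|_{G_{N,\lambda}}\le\sqrt{2\ln\left(\frac{\det(G_{N,\lambda})^{1/2}}{\delta\,\det(\lambda I_d)^{1/2}}\right)}+(\lambda d)^{1/2}S .$$ -/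

import Mathlib

open MeasureTheory ProbabilityTheory
open scoped Matrix

noncomputable section

namespace ConfidenceEllipsoid

variable {p d : ℕ} {Ω : Type*}

/-- The weighted Euclidean norm `‖x‖_M = (xᵀ M x)^{1/2}`, for a positive definite matrix `M`. -/
def weightedNorm {k : ℕ} (M : Matrix (Fin k) (Fin k) ℝ) (x : Fin k → ℝ) : ℝ :=
  Real.sqrt (x ⬝ᵥ M *ᵥ x)

/-- The regularised Gram matrix `G_{N,lam} = ∑_{n=1}^N Φₙᵀ Sig⁻¹ Φₙ + lam I_d`
(`Sig` is the weight matrix `Σ_p`). -/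
def gram (Sig : Matrix (Fin p) (Fin p) ℝ) (lam : ℝ) (Φ : ℕ → Matrix (Fin p) (Fin d) ℝ) (N : ℕ) :
    Matrix (Fin d) (Fin d) ℝ :=
  (∑ n ∈ Finset.Icc 1 N, (Φ n)ᵀ * Sig⁻¹ * Φ n) + lam • (1 : Matrix (Fin d) (Fin d) ℝ)

/-- The regularised least-squares estimator
`θ_{N,lam} = G_{N,lam}⁻¹ ∑_{n=1}^N Φₙᵀ Sig⁻¹ yₙ`. -/
def rlsEstimator (Sig : Matrix (Fin p) (Fin p) ℝ) (lam : ℝ) (Φ : ℕ → Matrix (Fin p) (Fin d) ℝ)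
    (y : ℕ → Fin p → ℝ) (N : ℕ) : Fin d → ℝ :=
  (gram Sig lam Φ N)⁻¹ *ᵥ ∑ n ∈ Finset.Icc 1 N, ((Φ n)ᵀ * Sig⁻¹) *ᵥ y n

/-- The objective of the regularised regression problem,
`∑_{n=1}^N ‖yₙ - Φₙ ϑ‖²_{Sig⁻¹} + lam ‖ϑ‖²`. -/
def rlsCost (Sig : Matrix (Fin p) (Fin p) ℝ) (lam : ℝ) (Φ : ℕ → Matrix (Fin p) (Fin d) ℝ)
    (y : ℕ → Fin p → ℝ) (N : ℕ) (ϑ : Fin d → ℝ) : ℝ :=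
  (∑ n ∈ Finset.Icc 1 N, weightedNorm Sig⁻¹ (y n - Φ n *ᵥ ϑ) ^ 2) + lam * (ϑ ⬝ᵥ ϑ)

/-- The radius `β_N(δ)` of the confidence ellipsoid, with `S` the bound on the coordinates of the
parameter. -/
def radius (Sig : Matrix (Fin p) (Fin p) ℝ) (lam S δ : ℝ) (Φ : ℕ → Matrix (Fin p) (Fin d) ℝ)
    (N : ℕ) : ℝ :=
  Real.sqrt (2 * Real.log (Real.sqrt (gram Sig lam Φ N).det /
      (δ * Real.sqrt (lam • (1 : Matrix (Fin d) (Fin d) ℝ)).det))) +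
    Real.sqrt (lam * d) * S

/-- `X` is sub-Gaussian with covariance proxy `Sig`. -/
def IsSubGaussian (Sig : Matrix (Fin p) (Fin p) ℝ) {mΩ : MeasurableSpace Ω}
    (X : Ω → Fin p → ℝ) (μ : Measure Ω) : Prop :=
  ∀ u : Fin p → ℝ, Integrable (fun ω ↦ Real.exp (u ⬝ᵥ X ω)) μ ∧
    ∫ ω, Real.exp (u ⬝ᵥ X ω) ∂μ ≤ Real.exp (1 / 2 * (u ⬝ᵥ Sig *ᵥ u))

/-- `X` is, conditionally on the sub-σ-algebra `m`, sub-Gaussian with covariance proxy `Sig`. -/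
def IsCondSubGaussian (Sig : Matrix (Fin p) (Fin p) ℝ) (m : MeasurableSpace Ω)
    {mΩ : MeasurableSpace Ω} (X : Ω → Fin p → ℝ) (μ : Measure Ω) : Prop :=
  ∀ u : Fin p → ℝ, Integrable (fun ω ↦ Real.exp (u ⬝ᵥ X ω)) μ ∧
    ∀ᵐ ω ∂μ, (μ[fun ω' ↦ Real.exp (u ⬝ᵥ X ω') | m]) ω ≤ Real.exp (1 / 2 * (u ⬝ᵥ Sig *ᵥ u))

/-- Sub-Gaussian noise that is independent of `m` is sub-Gaussian conditionally on `m`. -/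
theorem IsSubGaussian.isCondSubGaussian {m mΩ : MeasurableSpace Ω}
    {Sig : Matrix (Fin p) (Fin p) ℝ} {X : Ω → Fin p → ℝ} {μ : Measure Ω} [IsProbabilityMeasure μ] (h : IsSubGaussian Sig X μ) (hX : Measurable X)
    (hm : m ≤ mΩ) (hind : Indep (MeasurableSpace.comap X inferInstance) m μ) :
    IsCondSubGaussian Sig m X μ := by
  intro u
  refine ⟨(h u).1, ?_⟩
  have hmeas : StronglyMeasurable[MeasurableSpace.comap X inferInstance]
      (fun ω ↦ Real.exp (u ⬝ᵥ X ω)) := by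
    have h1 : Measurable (fun x : Fin p → ℝ ↦ Real.exp (u ⬝ᵥ x)) := by
      unfold dotProduct; fun_prop
    exact (h1.comp (comap_measurable X)).stronglyMeasurable
  filter_upwards [condExp_indep_eq hX.comap_le hm hmeas hind] with ω hω
  rw [hω]
  exact (h u).2

theorem gram_posDef {Sig : Matrix (Fin p) (Fin p) ℝ} (hS : Sig.PosDef) {lam : ℝ} (hlam : 0 < lam)
    (Φ : ℕ → Matrix (Fin p) (Fin d) ℝ) (N : ℕ) : (gram Sig lam Φ N).PosDef := by
  refine Matrix.PosDef.posSemidef_add ?_ (Matrix.PosDef.one.smul hlam)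
  refine Matrix.posSemidef_sum _ fun n _ ↦ ?_
  simpa using hS.inv.posSemidef.conjTranspose_mul_mul_same (Φ n)

/-- The cost exceeds its value at the estimator by a squared weighted distance. -/
theorem rlsCost_eq {Sig : Matrix (Fin p) (Fin p) ℝ} (hS : Sig.PosDef) {lam : ℝ} (hlam : 0 < lam)
    (Φ : ℕ → Matrix (Fin p) (Fin d) ℝ) (y : ℕ → Fin p → ℝ) (N : ℕ) (v : Fin d → ℝ) :
    rlsCost Sig lam Φ y N (rlsEstimator Sig lam Φ y N + v) =
      rlsCost Sig lam Φ y N (rlsEstimator Sig lam Φ y N) + v ⬝ᵥ gram Sig lam Φ N *ᵥ v := by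
  have hG : gram Sig lam Φ N *ᵥ rlsEstimator Sig lam Φ y N =
      ∑ n ∈ Finset.Icc 1 N, ((Φ n)ᵀ * Sig⁻¹) *ᵥ y n := by
    rw [rlsEstimator, Matrix.mulVec_mulVec, Matrix.mul_nonsing_inv _
      (gram_posDef hS hlam Φ N).det_pos.ne'.isUnit, Matrix.one_mulVec]
  set t := rlsEstimator Sig lam Φ y N
  have hsq : ∀ x, weightedNorm Sig⁻¹ x ^ 2 = x ⬝ᵥ Sig⁻¹ *ᵥ x := fun x ↦
    Real.sq_sqrt (by simpa using hS.inv.posSemidef.dotProduct_mulVec_nonneg x)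
  have hsymm : ∀ a b : Fin p → ℝ, a ⬝ᵥ Sig⁻¹ *ᵥ b = b ⬝ᵥ Sig⁻¹ *ᵥ a := by
    intro a b
    have hT : (Sig⁻¹)ᵀ = Sig⁻¹ := by simpa using hS.inv.isHermitian.eq
    rw [Matrix.dotProduct_mulVec, ← Matrix.mulVec_transpose, hT, dotProduct_comm]
  have hk : ∀ (n : ℕ) (w : Fin p → ℝ),
      v ⬝ᵥ ((Φ n)ᵀ * Sig⁻¹) *ᵥ w = (Φ n *ᵥ v) ⬝ᵥ Sig⁻¹ *ᵥ w := by
    intro n w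
    rw [← Matrix.mulVec_mulVec, Matrix.dotProduct_mulVec, Matrix.vecMul_transpose]
  have hgram : ∀ w, v ⬝ᵥ gram Sig lam Φ N *ᵥ w =
      ∑ n ∈ Finset.Icc 1 N, (Φ n *ᵥ v) ⬝ᵥ Sig⁻¹ *ᵥ (Φ n *ᵥ w) + lam * (v ⬝ᵥ w) := by
    intro w
    simp only [gram, Matrix.add_mulVec, Matrix.sum_mulVec, Matrix.smul_mulVec, Matrix.one_mulVec,
      dotProduct_add, dotProduct_sum, dotProduct_smul, smul_eq_mul]
    congr 1
    refine Finset.sum_congr rfl fun n _ ↦ ?_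
    rw [← Matrix.mulVec_mulVec, hk]
  have hb := congrArg (fun w ↦ v ⬝ᵥ w) hG
  simp only [hgram, dotProduct_sum, hk] at hb
  have hterm : ∀ n, (y n - Φ n *ᵥ (t + v)) ⬝ᵥ Sig⁻¹ *ᵥ (y n - Φ n *ᵥ (t + v)) =
      (y n - Φ n *ᵥ t) ⬝ᵥ Sig⁻¹ *ᵥ (y n - Φ n *ᵥ t) + (Φ n *ᵥ v) ⬝ᵥ Sig⁻¹ *ᵥ (Φ n *ᵥ v)
        - 2 * ((Φ n *ᵥ v) ⬝ᵥ Sig⁻¹ *ᵥ y n) + 2 * ((Φ n *ᵥ v) ⬝ᵥ Sig⁻¹ *ᵥ (Φ n *ᵥ t)) := by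
    intro n
    simp only [Matrix.mulVec_add, Matrix.mulVec_sub, dotProduct_add, dotProduct_sub,
      add_dotProduct, sub_dotProduct]
    rw [hsymm (y n) (Φ n *ᵥ v), hsymm (Φ n *ᵥ t) (Φ n *ᵥ v)]
    ring
  simp only [rlsCost, hsq, hterm, hgram, Finset.sum_add_distrib, Finset.sum_sub_distrib,
    ← Finset.mul_sum, add_dotProduct, dotProduct_add]
  rw [dotProduct_comm t v]
  linarith

/-- The estimator is the unique solution of the regularised regression problem. -/
theorem isMinOn_rlsCost_iff {Sig : Matrix (Fin p) (Fin p) ℝ} (hS : Sig.PosDef) {lam : ℝ}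
    (hlam : 0 < lam) (Φ : ℕ → Matrix (Fin p) (Fin d) ℝ) (y : ℕ → Fin p → ℝ) (N : ℕ)
    (ϑ : Fin d → ℝ) :
    IsMinOn (rlsCost Sig lam Φ y N) Set.univ ϑ ↔ ϑ = rlsEstimator Sig lam Φ y N := by
  have hG := gram_posDef hS hlam Φ N
  constructor
  · intro h
    by_contra hne
    have h1 := h (Set.mem_univ (rlsEstimator Sig lam Φ y N))
    have h2 := rlsCost_eq hS hlam Φ y N (ϑ - rlsEstimator Sig lam Φ y N)
    have h3 := hG.dotProduct_mulVec_pos (sub_ne_zero.2 hne)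
    simp only [star_trivial, add_sub_cancel, Set.mem_ofPred_eq] at h1 h2 h3
    linarith
  · rintro rfl x -
    have h2 := rlsCost_eq hS hlam Φ y N (x - rlsEstimator Sig lam Φ y N)
    have h3 := hG.posSemidef.dotProduct_mulVec_nonneg (x - rlsEstimator Sig lam Φ y N)
    simp only [star_trivial, add_sub_cancel, Set.mem_ofPred_eq] at h2 h3 ⊢
    linarith

end ConfidenceEllipsoid

end

/-! Method of mixtures. Write `s` for the noise score. For fixed `x`, tilting the noise at time `n`
by the predictable direction `Sig⁻¹ Φₙ x` gives a nonnegative supermartingale of mean at most one,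
with value `exp (xᵀ s - xᵀ (G - lam I) x / 2)` at time `N`. Averaging over `x` with the Gaussian
weight `exp (-lam |x|² / 2)` completes the quadratic form to `G`, and the integral is explicit: `exp
(|s|²_{G⁻¹} / 2) / √det G`, up to the Gaussian mass. By Tonelli its mean is at most `1 / √det (lam
I)` up to the same mass, so Markov's inequality bounds `|s|_{G⁻¹}` outside an event of probability
at most `δ`. The rest is deterministic: the estimation error is `G⁻¹ s - lam G⁻¹ θ`, and the bias
term has `G`-norm at most `√(lam d) S`. -/

namespace ConfidenceEllipsoid

/-! ### Exponential supermartingale with predictable directions -/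

section Probability

variable {p : ℕ} {Ω : Type*} {m mΩ : MeasurableSpace Ω} {μ : Measure Ω} [IsProbabilityMeasure μ]
  {Sig : Matrix (Fin p) (Fin p) ℝ} {X : Ω → Fin p → ℝ}

/-- The logarithm of the normalised exponential `exp (uᵀ x - uᵀ Sig u / 2)`. -/
noncomputable def logTilt (Sig : Matrix (Fin p) (Fin p) ℝ) (u x : Fin p → ℝ) : ℝ :=
  u ⬝ᵥ x - 1 / 2 * (u ⬝ᵥ Sig *ᵥ u)

theorem continuous_logTilt (Sig : Matrix (Fin p) (Fin p) ℝ) :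
    Continuous fun z : (Fin p → ℝ) × (Fin p → ℝ) ↦ logTilt Sig z.1 z.2 := by
  unfold logTilt dotProduct Matrix.mulVec dotProduct
  fun_prop

theorem measurable_logTilt {α : Type*} {mα : MeasurableSpace α} {f g : α → Fin p → ℝ}
    (hf : Measurable f) (hg : Measurable g) : Measurable fun a ↦ logTilt Sig (f a) (g a) :=
  (continuous_logTilt Sig).measurable.comp (hf.prodMk hg)

theorem IsCondSubGaussian.setLIntegral_le (h : IsCondSubGaussian Sig m X μ) (hm : m ≤ mΩ)
    (u : Fin p → ℝ) {s : Set Ω} (hs : MeasurableSet[m] s) :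
    ∫⁻ ω in s, ENNReal.ofReal (Real.exp (logTilt Sig u (X ω))) ∂μ ≤ μ s := by
  obtain ⟨hi, hle⟩ := h u
  have hexp : ∀ ω, Real.exp (logTilt Sig u (X ω)) =
      Real.exp (u ⬝ᵥ X ω) * Real.exp (-(1 / 2 * (u ⬝ᵥ Sig *ᵥ u))) := fun ω ↦ by
    rw [← Real.exp_add, logTilt, sub_eq_add_neg]
  have h1 : ∫ ω in s, Real.exp (u ⬝ᵥ X ω) ∂μ ≤
      μ.real s * Real.exp (1 / 2 * (u ⬝ᵥ Sig *ᵥ u)) := by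
    rw [← setIntegral_condExp hm hi hs, ← smul_eq_mul, ← setIntegral_const]
    exact setIntegral_mono_ae integrable_condExp.integrableOn (integrable_const _).integrableOn hle
  simp only [hexp]
  rw [← ofReal_integral_eq_lintegral_ofReal (hi.integrableOn.mul_const _)
    (.of_forall fun ω ↦ by positivity), integral_mul_const]
  refine ENNReal.ofReal_le_of_le_toReal ?_
  calc _ ≤ μ.real s * Real.exp (1 / 2 * (u ⬝ᵥ Sig *ᵥ u)) *
        Real.exp (-(1 / 2 * (u ⬝ᵥ Sig *ᵥ u))) := by gcongr
    _ = _ := by rw [mul_assoc, ← Real.exp_add, add_neg_cancel, Real.exp_zero, mul_one]; rfl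

/-- The bound on events of `m` says that the measure with the tilt as density, restricted to `m`, is
dominated by `μ`. Integrals of `m`-measurable weights then compare, with no integrability needed. -/
theorem IsCondSubGaussian.lintegral_mul_le_const (h : IsCondSubGaussian Sig m X μ) (hm : m ≤ mΩ)
    (hX : Measurable X) (u : Fin p → ℝ) {W : Ω → ENNReal} (hW : Measurable[m] W) :
    ∫⁻ ω, W ω * ENNReal.ofReal (Real.exp (logTilt Sig u (X ω))) ∂μ ≤ ∫⁻ ω, W ω ∂μ := by
  set f : Ω → ENNReal := fun ω ↦ ENNReal.ofReal (Real.exp (logTilt Sig u (X ω)))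
  have hf : Measurable f :=
    (Real.measurable_exp.comp (measurable_logTilt measurable_const hX)).ennreal_ofReal
  have htrim : (μ.withDensity f).trim hm ≤ μ.trim hm := by
    refine @Measure.le_iff _ m _ _ |>.2 fun s hs ↦ ?_
    rw [trim_measurableSet_eq hm hs, trim_measurableSet_eq hm hs, withDensity_apply _ (hm s hs)]
    exact h.setLIntegral_le hm u hs
  calc _ = ∫⁻ ω, W ω ∂μ.withDensity f := by
        rw [lintegral_withDensity_eq_lintegral_mul _ hf (hW.mono hm le_rfl)]
        simp [mul_comm, f]
    _ ≤ _ := by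
        rw [← lintegral_trim hm hW, ← lintegral_trim hm hW]
        exact lintegral_mono' htrim le_rfl

/-- On each fibre of `U` the direction is constant, and the indicator of the fibre can be absorbed
into the weight because the fibre lies in `m`. -/
theorem IsCondSubGaussian.lintegral_mul_le_simpleFunc (h : IsCondSubGaussian Sig m X μ)
    (hm : m ≤ mΩ) (hX : Measurable X) (U : @SimpleFunc Ω m (Fin p → ℝ)) {W : Ω → ENNReal}
    (hW : Measurable[m] W) :
    ∫⁻ ω, W ω * ENNReal.ofReal (Real.exp (logTilt Sig (U ω) (X ω))) ∂μ ≤ ∫⁻ ω, W ω ∂μ := by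
  have key : ∀ g : (Fin p → ℝ) → Ω → ENNReal, ∀ ω, W ω * g (U ω) ω =
      ∑ u ∈ @SimpleFunc.range _ _ m U, (U ⁻¹' {u}).indicator W ω * g u ω := by
    intro g ω
    rw [Finset.sum_eq_single (U ω)]
    · simp
    · intro u _ hu
      simp [Set.indicator_of_notMem, hu.symm]
    · intro hu
      exact (hu (@SimpleFunc.mem_range_self _ _ m U ω)).elim
  have hWi : ∀ u, Measurable[m] ((U ⁻¹' {u}).indicator W) := fun u ↦
    hW.indicator (@SimpleFunc.measurableSet_fiber _ _ m U u)
  calc _ = ∑ u ∈ @SimpleFunc.range _ _ m U, ∫⁻ ω, (U ⁻¹' {u}).indicator W ω *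
        ENNReal.ofReal (Real.exp (logTilt Sig u (X ω))) ∂μ := by
        rw [← lintegral_finsetSum]
        · exact lintegral_congr fun ω ↦
            key (fun u ω ↦ ENNReal.ofReal (Real.exp (logTilt Sig u (X ω)))) ω
        · exact fun u _ ↦ ((hWi u).mono hm le_rfl).mul
            (Real.measurable_exp.comp (measurable_logTilt measurable_const hX)).ennreal_ofReal
    _ ≤ ∑ u ∈ @SimpleFunc.range _ _ m U, ∫⁻ ω, (U ⁻¹' {u}).indicator W ω ∂μ :=
        Finset.sum_le_sum fun u _ ↦ h.lintegral_mul_le_const hm hX u (hWi u)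
    _ = _ := by
        rw [← lintegral_finsetSum _ fun u _ ↦ (hWi u).mono hm le_rfl]
        exact lintegral_congr fun ω ↦ by simpa using (key (fun _ _ ↦ 1) ω).symm

/-- The sub-Gaussian bound extends to random directions that are known to the past. -/
theorem IsCondSubGaussian.lintegral_mul_le (h : IsCondSubGaussian Sig m X μ)
    (hm : m ≤ mΩ) (hX : Measurable X) {U : Ω → Fin p → ℝ} (hU : Measurable[m] U)
    {W : Ω → ENNReal} (hW : Measurable[m] W) (hWtop : ∀ ω, W ω ≠ ⊤) :
    ∫⁻ ω, W ω * ENNReal.ofReal (Real.exp (logTilt Sig (U ω) (X ω))) ∂μ ≤ ∫⁻ ω, W ω ∂μ := by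
  have hUs : StronglyMeasurable[m] U := hU.stronglyMeasurable
  set V := hUs.approx
  have hVm : ∀ n, Measurable (V n) := fun n ↦
    (@SimpleFunc.measurable _ _ m _ (V n)).mono hm le_rfl
  have hlim : ∀ ω, Filter.Tendsto
      (fun n ↦ W ω * ENNReal.ofReal (Real.exp (logTilt Sig (V n ω) (X ω)))) Filter.atTop
      (nhds (W ω * ENNReal.ofReal (Real.exp (logTilt Sig (U ω) (X ω))))) := by
    intro ω
    have hc : Continuous fun u ↦ ENNReal.ofReal (Real.exp (logTilt Sig u (X ω))) :=
      ENNReal.continuous_ofReal.comp (Real.continuous_exp.comp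
        ((continuous_logTilt Sig).comp (continuous_id.prodMk continuous_const)))
    exact ENNReal.Tendsto.const_mul ((hc.tendsto (U ω)).comp (hUs.tendsto_approx ω))
      (Or.inr (hWtop ω))
  -- Fatou's lemma replaces dominated convergence, so no bound on `U` is required.
  calc _ = ∫⁻ ω, Filter.liminf
        (fun n ↦ W ω * ENNReal.ofReal (Real.exp (logTilt Sig (V n ω) (X ω)))) Filter.atTop ∂μ :=
        lintegral_congr fun ω ↦ (hlim ω).liminf_eq.symm
    _ ≤ Filter.liminf (fun n ↦
        ∫⁻ ω, W ω * ENNReal.ofReal (Real.exp (logTilt Sig (V n ω) (X ω))) ∂μ) Filter.atTop :=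
        lintegral_liminf_le fun n ↦ (hW.mono hm le_rfl).mul
          (Real.measurable_exp.comp (measurable_logTilt (hVm n) hX)).ennreal_ofReal
    _ ≤ _ := Filter.liminf_le_of_le (by isBoundedDefault) fun b hb ↦ by
        obtain ⟨n, hn⟩ := hb.exists
        exact hn.trans (h.lintegral_mul_le_simpleFunc hm hX (V n) hW)

/-- The exponential supermartingale has expectation at most one. -/
theorem lintegral_exp_sum_logTilt_le_one (ℱ : Filtration ℕ mΩ) {U η : ℕ → Ω → Fin p → ℝ}
    (hU : ∀ n, Measurable[ℱ n] (U (n + 1))) (hη : ∀ n, Measurable[ℱ (n + 1)] (η (n + 1)))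
    (hsub : ∀ n, IsCondSubGaussian Sig (ℱ n) (η (n + 1)) μ) (N : ℕ) :
    ∫⁻ ω, ENNReal.ofReal (Real.exp (∑ n ∈ Finset.Icc 1 N, logTilt Sig (U n ω) (η n ω))) ∂μ ≤ 1 := by
  induction N with
  | zero => simp
  | succ N ih =>
    have hmeas : Measurable[ℱ N]
        (fun ω ↦ ∑ n ∈ Finset.Icc 1 N, logTilt Sig (U n ω) (η n ω)) := by
      refine Finset.measurable_fun_sum _ fun n hn ↦ ?_
      obtain ⟨h1, h2⟩ := Finset.mem_Icc.1 hn
      obtain ⟨k, rfl⟩ := Nat.exists_eq_add_of_le' h1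
      exact measurable_logTilt ((hU k).mono (ℱ.mono (by omega)) le_rfl)
        ((hη k).mono (ℱ.mono h2) le_rfl)
    refine le_trans (le_of_eq (lintegral_congr fun ω ↦ ?_)) (((hsub N).lintegral_mul_le (ℱ.le N)
      ((hη N).mono (ℱ.le _) le_rfl) (hU N) (Real.measurable_exp.comp hmeas).ennreal_ofReal
      (fun _ ↦ ENNReal.ofReal_ne_top)).trans ih)
    rw [Finset.sum_Icc_succ_top (by omega), Real.exp_add, ENNReal.ofReal_mul (Real.exp_pos _).le]
    rfl

end Probability

/-! ### Gaussian integrals for a positive definite form -/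

section Gaussian

variable {d : ℕ} {G : Matrix (Fin d) (Fin d) ℝ}

open scoped MatrixOrder Matrix.Norms.L2Operator in
theorem exists_transpose_mul_self_of_posDef (hG : G.PosDef) :
    ∃ B : Matrix (Fin d) (Fin d) ℝ, G = Bᵀ * B ∧ B.det ≠ 0 ∧ |B.det| = Real.sqrt G.det := by
  obtain ⟨B, hB⟩ : ∃ B : Matrix (Fin d) (Fin d) ℝ, G = Bᵀ * B := by
    obtain ⟨B, hB⟩ := CStarAlgebra.nonneg_iff_eq_star_mul_self.mp hG.posSemidef.nonneg
    exact ⟨B, by simpa [Matrix.star_eq_conjTranspose] using hB⟩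
  have hdet : G.det = B.det ^ 2 := by rw [hB, Matrix.det_mul, Matrix.det_transpose, sq]
  refine ⟨B, hB, fun h ↦ hG.det_pos.ne' (by simp [hdet, h]), ?_⟩
  rw [hdet, Real.sqrt_sq_eq_abs]

theorem dotProduct_transpose_mul_self_mulVec (B : Matrix (Fin d) (Fin d) ℝ) (x y : Fin d → ℝ) :
    x ⬝ᵥ (Bᵀ * B) *ᵥ y = (B *ᵥ x) ⬝ᵥ (B *ᵥ y) := by
  rw [← Matrix.mulVec_mulVec, Matrix.dotProduct_mulVec, Matrix.vecMul_transpose]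

theorem dotProduct_mulVec_comm_of_posDef (hG : G.PosDef) (x y : Fin d → ℝ) :
    x ⬝ᵥ G *ᵥ y = y ⬝ᵥ G *ᵥ x := by
  obtain ⟨B, rfl, -⟩ := exists_transpose_mul_self_of_posDef hG
  rw [dotProduct_transpose_mul_self_mulVec, dotProduct_transpose_mul_self_mulVec, dotProduct_comm]

theorem mulVec_inv_mulVec_of_posDef (hG : G.PosDef) (x : Fin d → ℝ) : G *ᵥ (G⁻¹ *ᵥ x) = x := by
  rw [Matrix.mulVec_mulVec, Matrix.mul_nonsing_inv _ hG.det_pos.ne'.isUnit, Matrix.one_mulVec]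

theorem weightedNorm_sub_le (hG : G.PosDef) (x y : Fin d → ℝ) :
    weightedNorm G (x - y) ≤ weightedNorm G x + weightedNorm G y := by
  obtain ⟨B, rfl, -⟩ := exists_transpose_mul_self_of_posDef hG
  have h : ∀ z, weightedNorm (Bᵀ * B) z = ‖WithLp.toLp 2 (B *ᵥ z)‖ := fun z ↦ by
    rw [weightedNorm, dotProduct_transpose_mul_self_mulVec, EuclideanSpace.norm_eq]
    simp [dotProduct, sq]
  rw [h, h, h, Matrix.mulVec_sub, WithLp.toLp_sub]
  exact norm_sub_le _ _

/-- The mass of the unnormalised standard Gaussian density. -/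
noncomputable def gaussianMass (d : ℕ) : ENNReal :=
  ∫⁻ x : Fin d → ℝ, ENNReal.ofReal (Real.exp (-(1 / 2) * (x ⬝ᵥ x)))

theorem measurable_exp_neg_half_dotProduct_self :
    Measurable fun x : Fin d → ℝ ↦ ENNReal.ofReal (Real.exp (-(1 / 2) * (x ⬝ᵥ x))) := by
  unfold dotProduct
  fun_prop

/-- The value of the mass is never needed: being nonzero and finite, it cancels in Markov's
inequality. -/
theorem gaussianMass_ne_zero (d : ℕ) : gaussianMass d ≠ 0 := by
  rw [gaussianMass, Ne, lintegral_eq_zero_iff measurable_exp_neg_half_dotProduct_self]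
  intro h
  obtain ⟨x, hx⟩ := h.exists
  exact (ENNReal.ofReal_pos.2 (Real.exp_pos _)).ne' hx

theorem gaussianMass_ne_top (d : ℕ) : gaussianMass d ≠ ⊤ := by
  have h : Integrable (fun x : Fin d → ℝ ↦ Real.exp (-(1 / 2) * (x ⬝ᵥ x))) := by
    have h1 := Integrable.fintype_prod (ι := Fin d) (μ := fun _ ↦ volume)
      (f := fun _ (t : ℝ) ↦ Real.exp (-(1 / 2) * t ^ 2))
      fun _ ↦ integrable_exp_neg_mul_sq (by norm_num)
    refine h1.congr (.of_forall fun x ↦ ?_)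
    simp [← Real.exp_sum, dotProduct, Finset.mul_sum, sq]
  rw [gaussianMass, ← ofReal_integral_eq_lintegral_ofReal h
    (.of_forall fun x ↦ (Real.exp_pos _).le)]
  exact ENNReal.ofReal_ne_top

/-- Complete the square at `G⁻¹ s`, translate, then substitute `B x` with `G = Bᵀ B`, whose Jacobian
is `√det G`. -/
theorem lintegral_exp_linear_sub_quadratic (hG : G.PosDef) (s : Fin d → ℝ) :
    ∫⁻ x : Fin d → ℝ, ENNReal.ofReal (Real.exp (x ⬝ᵥ s - 1 / 2 * (x ⬝ᵥ G *ᵥ x))) =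
      ENNReal.ofReal (Real.exp (1 / 2 * (s ⬝ᵥ G⁻¹ *ᵥ s)) / Real.sqrt G.det) * gaussianMass d := by
  have hsquare : ∀ x, x ⬝ᵥ s - 1 / 2 * (x ⬝ᵥ G *ᵥ x) = 1 / 2 * (s ⬝ᵥ G⁻¹ *ᵥ s) +
      -(1 / 2) * ((x - G⁻¹ *ᵥ s) ⬝ᵥ G *ᵥ (x - G⁻¹ *ᵥ s)) := by
    intro x
    have h := mulVec_inv_mulVec_of_posDef hG s
    simp only [Matrix.mulVec_sub, dotProduct_sub, sub_dotProduct]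
    rw [dotProduct_mulVec_comm_of_posDef hG (G⁻¹ *ᵥ s) x, h, dotProduct_comm (G⁻¹ *ᵥ s) s]
    ring
  obtain ⟨B, hB, hdet, habs⟩ := exists_transpose_mul_self_of_posDef hG
  have hquad : ∫⁻ x : Fin d → ℝ, ENNReal.ofReal (Real.exp (-(1 / 2) * (x ⬝ᵥ G *ᵥ x))) =
      ENNReal.ofReal (Real.sqrt G.det)⁻¹ * gaussianMass d := by
    have hmap := lintegral_map (μ := volume) (g := Matrix.toLin' B)
      (measurable_exp_neg_half_dotProduct_self (d := d))
      (LinearMap.continuous_on_pi _).measurable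
    rw [Real.map_matrix_volume_pi_eq_smul_volume_pi hdet, lintegral_smul_measure, abs_inv, habs]
      at hmap
    rw [gaussianMass, ← smul_eq_mul, hmap]
    simp [hB, dotProduct_transpose_mul_self_mulVec]
  simp only [hsquare, Real.exp_add, ENNReal.ofReal_mul (Real.exp_pos _).le]
  rw [lintegral_const_mul' _ _ ENNReal.ofReal_ne_top,
    lintegral_sub_right_eq_self
      (fun x ↦ ENNReal.ofReal (Real.exp (-(1 / 2) * (x ⬝ᵥ G *ᵥ x)))) (G⁻¹ *ᵥ s), hquad,
    ← mul_assoc, ← ENNReal.ofReal_mul (Real.exp_pos _).le, ← div_eq_mul_inv]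

end Gaussian

/-! ### Deterministic error decomposition -/

section Regression

variable {p d : ℕ} {Sig : Matrix (Fin p) (Fin p) ℝ} {lam : ℝ}

/-- The weighted noise term `∑_{n=1}^N Φₙᵀ Sig⁻¹ ηₙ` in the normal equations. -/
noncomputable def noiseScore (Sig : Matrix (Fin p) (Fin p) ℝ) (Φ : ℕ → Matrix (Fin p) (Fin d) ℝ)
    (η : ℕ → Fin p → ℝ) (N : ℕ) : Fin d → ℝ :=
  ∑ n ∈ Finset.Icc 1 N, ((Φ n)ᵀ * Sig⁻¹) *ᵥ η n

theorem dotProduct_transpose_mul_mulVec (A : Matrix (Fin p) (Fin d) ℝ)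
    (M : Matrix (Fin p) (Fin p) ℝ) (x : Fin d → ℝ) (z : Fin p → ℝ) :
    x ⬝ᵥ (Aᵀ * M) *ᵥ z = (A *ᵥ x) ⬝ᵥ M *ᵥ z := by
  rw [← Matrix.mulVec_mulVec, Matrix.dotProduct_mulVec, Matrix.vecMul_transpose]

theorem gram_mulVec (Φ : ℕ → Matrix (Fin p) (Fin d) ℝ) (N : ℕ) (x : Fin d → ℝ) :
    gram Sig lam Φ N *ᵥ x =
      ∑ n ∈ Finset.Icc 1 N, ((Φ n)ᵀ * Sig⁻¹) *ᵥ (Φ n *ᵥ x) + lam • x := by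
  simp only [gram, Matrix.add_mulVec, Matrix.sum_mulVec, Matrix.smul_mulVec, Matrix.one_mulVec,
    Matrix.mulVec_mulVec]

/-- With direction `Sig⁻¹ Φₙ x`, the proxy variance collapses to `(Φₙ x)ᵀ Sig⁻¹ (Φₙ x)`, which is
the Gram contribution of time `n`. -/
theorem sum_logTilt_sub_eq (hS : Sig.PosDef) (Φ : ℕ → Matrix (Fin p) (Fin d) ℝ)
    (η : ℕ → Fin p → ℝ) (N : ℕ) (x : Fin d → ℝ) :
    ∑ n ∈ Finset.Icc 1 N, logTilt Sig (Sig⁻¹ *ᵥ (Φ n *ᵥ x)) (η n) - 1 / 2 * (lam * (x ⬝ᵥ x)) =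
      x ⬝ᵥ noiseScore Sig Φ η N - 1 / 2 * (x ⬝ᵥ gram Sig lam Φ N *ᵥ x) := by
  have h1 : ∀ n, logTilt Sig (Sig⁻¹ *ᵥ (Φ n *ᵥ x)) (η n) =
      (Φ n *ᵥ x) ⬝ᵥ Sig⁻¹ *ᵥ η n - 1 / 2 * ((Φ n *ᵥ x) ⬝ᵥ Sig⁻¹ *ᵥ (Φ n *ᵥ x)) := fun n ↦ by
    rw [logTilt, mulVec_inv_mulVec_of_posDef hS, dotProduct_comm _ (η n),
      dotProduct_mulVec_comm_of_posDef hS.inv (η n), dotProduct_comm (Sig⁻¹ *ᵥ _) (Φ n *ᵥ x)]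
  simp only [h1, noiseScore, gram_mulVec, dotProduct_add, dotProduct_sum, dotProduct_smul,
    dotProduct_transpose_mul_mulVec, Finset.sum_sub_distrib, ← Finset.mul_sum, smul_eq_mul]
  ring

theorem rlsEstimator_sub_eq (hS : Sig.PosDef) (hlam : 0 < lam) {Φ : ℕ → Matrix (Fin p) (Fin d) ℝ}
    {η y : ℕ → Fin p → ℝ} {θ : Fin d → ℝ}
    (hy : ∀ n, y (n + 1) = Φ (n + 1) *ᵥ θ + η (n + 1)) (N : ℕ) :
    rlsEstimator Sig lam Φ y N - θ = (gram Sig lam Φ N)⁻¹ *ᵥ noiseScore Sig Φ η N -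
      lam • ((gram Sig lam Φ N)⁻¹ *ᵥ θ) := by
  have hG := gram_posDef hS hlam Φ N
  have h1 : ∑ n ∈ Finset.Icc 1 N, ((Φ n)ᵀ * Sig⁻¹) *ᵥ y n =
      gram Sig lam Φ N *ᵥ θ - lam • θ + noiseScore Sig Φ η N := by
    rw [gram_mulVec, add_sub_cancel_right, noiseScore, ← Finset.sum_add_distrib]
    refine Finset.sum_congr rfl fun n hn ↦ ?_
    obtain ⟨k, rfl⟩ := Nat.exists_eq_add_of_le' (Finset.mem_Icc.1 hn).1
    rw [hy, Matrix.mulVec_add]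
  rw [rlsEstimator, h1, Matrix.mulVec_add, Matrix.mulVec_sub, Matrix.mulVec_mulVec,
    Matrix.nonsing_inv_mul _ hG.det_pos.ne'.isUnit, Matrix.one_mulVec, Matrix.mulVec_smul]
  abel

theorem weightedNorm_inv_mulVec {G : Matrix (Fin d) (Fin d) ℝ} (hG : G.PosDef) (s : Fin d → ℝ) :
    weightedNorm G (G⁻¹ *ᵥ s) = Real.sqrt (s ⬝ᵥ G⁻¹ *ᵥ s) := by
  rw [weightedNorm, mulVec_inv_mulVec_of_posDef hG, dotProduct_comm]

theorem dotProduct_self_le_dotProduct_gram_mulVec (hS : Sig.PosDef)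
    (Φ : ℕ → Matrix (Fin p) (Fin d) ℝ) (N : ℕ) (z : Fin d → ℝ) :
    lam * (z ⬝ᵥ z) ≤ z ⬝ᵥ gram Sig lam Φ N *ᵥ z := by
  simp only [gram_mulVec, dotProduct_add, dotProduct_sum, dotProduct_smul, smul_eq_mul,
    dotProduct_transpose_mul_mulVec]
  refine le_add_of_nonneg_left (Finset.sum_nonneg fun n _ ↦ ?_)
  simpa using hS.inv.posSemidef.dotProduct_mulVec_nonneg (Φ n *ᵥ z)

/-- With `G z = θ` the squared norm is `lam² zᵀθ`. Expanding `|θ - lam z|² ≥ 0` and using `lam |z|²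
≤ zᵀθ` gives `lam zᵀθ ≤ |θ|² ≤ d S²`. -/
theorem weightedNorm_smul_inv_gram_mulVec_le (hS : Sig.PosDef) (hlam : 0 < lam)
    (Φ : ℕ → Matrix (Fin p) (Fin d) ℝ) (N : ℕ) {θ : Fin d → ℝ} {S : ℝ}
    (hθ : ∀ i, θ i ∈ Set.Icc (-S) S) :
    weightedNorm (gram Sig lam Φ N) (lam • ((gram Sig lam Φ N)⁻¹ *ᵥ θ)) ≤
      Real.sqrt (lam * d) * S := by
  have hG := gram_posDef hS hlam Φ N
  set z := (gram Sig lam Φ N)⁻¹ *ᵥ θ with hz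
  have hGz : gram Sig lam Φ N *ᵥ z = θ := mulVec_inv_mulVec_of_posDef hG θ
  have h1 := dotProduct_self_le_dotProduct_gram_mulVec (lam := lam) hS Φ N z
  have h2 : 0 ≤ (θ - lam • z) ⬝ᵥ (θ - lam • z) :=
    Finset.sum_nonneg fun i _ ↦ mul_self_nonneg _
  simp only [dotProduct_sub, sub_dotProduct, dotProduct_smul, smul_dotProduct, smul_eq_mul,
    dotProduct_comm θ z] at h2
  rw [hGz] at h1
  have h3 : θ ⬝ᵥ θ ≤ d * S ^ 2 := by
    calc θ ⬝ᵥ θ ≤ ∑ _i : Fin d, S ^ 2 := Finset.sum_le_sum fun i _ ↦ by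
          nlinarith [(hθ i).1, (hθ i).2]
      _ = d * S ^ 2 := by simp
  have h4 : lam * (z ⬝ᵥ θ) ≤ d * S ^ 2 := by nlinarith
  have hnorm : weightedNorm (gram Sig lam Φ N) (lam • z) ≤ Real.sqrt (lam * d * S ^ 2) := by
    rw [weightedNorm, Matrix.mulVec_smul, hGz, dotProduct_smul, smul_dotProduct, smul_eq_mul,
      smul_eq_mul, mul_assoc]
    exact Real.sqrt_le_sqrt (mul_le_mul_of_nonneg_left h4 hlam.le)
  refine hnorm.trans (le_of_eq ?_)
  rw [Real.sqrt_mul (by positivity), Real.sqrt_sq_eq_abs]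
  -- For `d = 0` nothing forces `S ≥ 0`, but the factor `√(lam d)` vanishes.
  rcases Nat.eq_zero_or_pos d with rfl | hd
  · simp
  · rw [abs_of_nonneg]
    linarith [(hθ ⟨0, hd⟩).1, (hθ ⟨0, hd⟩).2]

theorem weightedNorm_rlsEstimator_sub_le (hS : Sig.PosDef) (hlam : 0 < lam) {δ : ℝ} (hδ : 0 < δ)
    {Φ : ℕ → Matrix (Fin p) (Fin d) ℝ} {η y : ℕ → Fin p → ℝ} {θ : Fin d → ℝ} {S : ℝ}
    (hθ : ∀ i, θ i ∈ Set.Icc (-S) S)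
    (hy : ∀ n, y (n + 1) = Φ (n + 1) *ᵥ θ + η (n + 1)) {N : ℕ}
    (h : Real.exp (1 / 2 * (noiseScore Sig Φ η N ⬝ᵥ (gram Sig lam Φ N)⁻¹ *ᵥ noiseScore Sig Φ η N)) /
        Real.sqrt (gram Sig lam Φ N).det ≤
      1 / (δ * Real.sqrt (lam • (1 : Matrix (Fin d) (Fin d) ℝ)).det)) :
    weightedNorm (gram Sig lam Φ N) (rlsEstimator Sig lam Φ y N - θ) ≤
      radius Sig lam S δ Φ N := by
  have hG := gram_posDef hS hlam Φ N
  have hdet := Real.sqrt_pos.2 hG.det_pos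
  have hdet1 := Real.sqrt_pos.2 ((Matrix.PosDef.one (n := Fin d) (R := ℝ)).smul hlam).det_pos
  rw [rlsEstimator_sub_eq hS hlam hy]
  refine (weightedNorm_sub_le hG _ _).trans
    (add_le_add ?_ (weightedNorm_smul_inv_gram_mulVec_le hS hlam Φ N hθ))
  rw [weightedNorm_inv_mulVec hG]
  refine Real.sqrt_le_sqrt ?_
  rw [div_le_iff₀ hdet, one_div_mul_eq_div (δ * _)] at h
  have hlog := (Real.le_log_iff_exp_le (by positivity)).2 h
  linarith

end Regression

/-! ### Gaussian mixture and Markov's inequality -/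

section Mixture

variable {p d : ℕ} {Ω : Type*} {mΩ : MeasurableSpace Ω} {μ : Measure Ω} [IsProbabilityMeasure μ]
  {Sig : Matrix (Fin p) (Fin p) ℝ} {lam : ℝ}

theorem measurable_mulVec {α : Type*} {mα : MeasurableSpace α} {k l : ℕ}
    {A : α → Matrix (Fin k) (Fin l) ℝ} {x : α → Fin l → ℝ}
    (hA : ∀ i j, Measurable fun a ↦ A a i j) (hx : Measurable x) :
    Measurable fun a ↦ A a *ᵥ x a := by
  refine measurable_pi_lambda _ fun i ↦ ?_
  exact Finset.measurable_fun_sum Finset.univ fun j _ ↦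
    (hA i j).mul ((measurable_pi_apply j).comp hx)

/-- Markov's inequality for the Gaussian mixture of the exponential supermartingales. -/
theorem measure_lt_exp_noiseScore_le (hS : Sig.PosDef) (hlam : 0 < lam) (ℱ : Filtration ℕ mΩ)
    {Φ : ℕ → Ω → Matrix (Fin p) (Fin d) ℝ} {η : ℕ → Ω → Fin p → ℝ}
    (hΦ : ∀ n i j, Measurable[ℱ n] (fun ω ↦ Φ (n + 1) ω i j))
    (hη : ∀ n, Measurable[ℱ (n + 1)] (η (n + 1)))
    (hsub : ∀ n, IsCondSubGaussian Sig (ℱ n) (η (n + 1)) μ) {δ : ℝ} (hδ : 0 < δ) (N : ℕ) :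
    μ {ω | 1 / (δ * Real.sqrt (lam • (1 : Matrix (Fin d) (Fin d) ℝ)).det) <
      Real.exp (1 / 2 * (noiseScore Sig (fun n ↦ Φ n ω) (fun n ↦ η n ω) N ⬝ᵥ
        (gram Sig lam (fun n ↦ Φ n ω) N)⁻¹ *ᵥ
          noiseScore Sig (fun n ↦ Φ n ω) (fun n ↦ η n ω) N)) /
        Real.sqrt (gram Sig lam (fun n ↦ Φ n ω) N).det} ≤ ENNReal.ofReal δ := by
  have hpos1 := (Matrix.PosDef.one (n := Fin d) (R := ℝ)).smul hlam
  have hdet1 := Real.sqrt_pos.2 hpos1.det_pos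
  set D := Real.sqrt (lam • (1 : Matrix (Fin d) (Fin d) ℝ)).det
  set M : Ω → (Fin d → ℝ) → ℝ := fun ω x ↦
    ∑ n ∈ Finset.Icc 1 N, logTilt Sig (Sig⁻¹ *ᵥ (Φ n ω *ᵥ x)) (η n ω)
  set h : Ω → (Fin d → ℝ) → ENNReal := fun ω x ↦
    ENNReal.ofReal (Real.exp (M ω x - 1 / 2 * (lam * (x ⬝ᵥ x))))
  set R : Ω → ℝ := fun ω ↦
    Real.exp (1 / 2 * (noiseScore Sig (fun n ↦ Φ n ω) (fun n ↦ η n ω) N ⬝ᵥ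
        (gram Sig lam (fun n ↦ Φ n ω) N)⁻¹ *ᵥ
          noiseScore Sig (fun n ↦ Φ n ω) (fun n ↦ η n ω) N)) /
        Real.sqrt (gram Sig lam (fun n ↦ Φ n ω) N).det
  have hh : Measurable (Function.uncurry h) := by
    have hq : Measurable fun z : Ω × (Fin d → ℝ) ↦ z.2 ⬝ᵥ z.2 := by
      unfold dotProduct
      fun_prop
    have hM : Measurable fun z : Ω × (Fin d → ℝ) ↦ M z.1 z.2 := by
      refine Finset.measurable_fun_sum _ fun n hn ↦ ?_
      obtain ⟨k, rfl⟩ := Nat.exists_eq_add_of_le' (Finset.mem_Icc.1 hn).1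
      exact measurable_logTilt (measurable_mulVec (fun _ _ ↦ measurable_const)
        (measurable_mulVec (fun i j ↦ ((hΦ k i j).mono (ℱ.le k) le_rfl).comp measurable_fst)
          measurable_snd)) (((hη k).mono (ℱ.le _) le_rfl).comp measurable_fst)
    exact (Real.measurable_exp.comp (hM.sub ((hq.const_mul _).const_mul _))).ennreal_ofReal
  have hR : ∀ ω, ∫⁻ x, h ω x = ENNReal.ofReal (R ω) * gaussianMass d := fun ω ↦ by
    rw [← lintegral_exp_linear_sub_quadratic (gram_posDef hS hlam _ N)]
    exact lintegral_congr fun x ↦ by simp only [h, M, sum_logTilt_sub_eq hS]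
  have hint : ∫⁻ ω, (∫⁻ x, h ω x) ∂μ ≤ ENNReal.ofReal (1 / D) * gaussianMass d := by
    rw [lintegral_lintegral_swap hh.aemeasurable]
    -- The prior's total mass is the case `s = 0`, `G = lam I` of the Gaussian integral.
    have hprior := lintegral_exp_linear_sub_quadratic hpos1 0
    simp only [dotProduct_zero, zero_dotProduct, mul_zero, Real.exp_zero, Matrix.smul_mulVec,
      Matrix.one_mulVec, dotProduct_smul, smul_eq_mul] at hprior
    rw [← hprior]
    refine lintegral_mono fun x ↦ ?_
    have hx := lintegral_exp_sum_logTilt_le_one (μ := μ) (Sig := Sig) ℱ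
      (U := fun n ω ↦ Sig⁻¹ *ᵥ (Φ n ω *ᵥ x))
      (fun n ↦ measurable_mulVec (fun _ _ ↦ measurable_const)
        (measurable_mulVec (hΦ n) measurable_const)) hη hsub N
    calc ∫⁻ ω, h ω x ∂μ = ∫⁻ ω, ENNReal.ofReal (Real.exp (0 - 1 / 2 * (lam * (x ⬝ᵥ x)))) *
          ENNReal.ofReal (Real.exp (M ω x)) ∂μ := lintegral_congr fun ω ↦ by
          rw [← ENNReal.ofReal_mul (Real.exp_pos _).le, ← Real.exp_add]
          simp only [h]
          ring_nf
      _ ≤ _ := by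
          rw [lintegral_const_mul' _ _ ENNReal.ofReal_ne_top]
          exact mul_le_of_le_one_right' hx
  have hc0 := gaussianMass_ne_zero d
  have hct := gaussianMass_ne_top d
  -- The level is `1 / δ` times the bound `hint` on the mean, so the exceedance probability is at
  -- most `δ`.
  have hmarkov := (mul_meas_ge_le_lintegral (μ := μ) hh.lintegral_prod_right'
    (ENNReal.ofReal (1 / (δ * D)) * gaussianMass d)).trans hint
  have hD : ENNReal.ofReal (1 / D) * gaussianMass d =
      ENNReal.ofReal (1 / (δ * D)) * gaussianMass d * ENNReal.ofReal δ := by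
    rw [mul_right_comm, ← ENNReal.ofReal_mul (by positivity)]
    congr 2
    field_simp
  rw [hD, ENNReal.mul_le_mul_iff_right (mul_ne_zero (ENNReal.ofReal_pos.2 (by positivity)).ne' hc0)
    (ENNReal.mul_ne_top ENNReal.ofReal_ne_top hct)] at hmarkov
  refine (measure_mono fun ω hω ↦ ?_).trans hmarkov
  simp only [Set.mem_ofPred_eq, Function.uncurry_apply_pair, hR] at hω ⊢
  gcongr

end Mixture

end ConfidenceEllipsoid

theorem mainTheorem2 {Ω : Type*} {mΩ : MeasurableSpace Ω} (μ : MeasureTheory.Measure Ω)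
    [MeasureTheory.IsProbabilityMeasure μ] {p d : ℕ}
    (Sig : Matrix (Fin p) (Fin p) ℝ) (hSig : Sig.PosDef)
    (ℱ : MeasureTheory.Filtration ℕ mΩ)
    (Φ : ℕ → Ω → Matrix (Fin p) (Fin d) ℝ) (η y : ℕ → Ω → Fin p → ℝ)
    (hΦ : ∀ n i j, Measurable[ℱ n] (fun ω ↦ Φ (n + 1) ω i j))
    (hη : ∀ n, Measurable[ℱ (n + 1)] (η (n + 1)))
    (hsub : ∀ n, ConfidenceEllipsoid.IsCondSubGaussian Sig (ℱ n) (η (n + 1)) μ)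
    (θ : Fin d → ℝ) (S : ℝ) (hθ : ∀ i, θ i ∈ Set.Icc (-S) S)
    (hy : ∀ n ω, y (n + 1) ω = Φ (n + 1) ω *ᵥ θ + η (n + 1) ω)
    (lam : ℝ) (hlam : 0 < lam) (δ : ℝ) (hδ : 0 < δ) (hδ_lt : δ < 1) (N : ℕ) :
    ENNReal.ofReal (1 - δ) ≤
      μ {ω | ConfidenceEllipsoid.weightedNorm
            (ConfidenceEllipsoid.gram Sig lam (fun n ↦ Φ n ω) N)
            (ConfidenceEllipsoid.rlsEstimator Sig lam (fun n ↦ Φ n ω) (fun n ↦ y n ω) N - θ) ≤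
          ConfidenceEllipsoid.radius Sig lam S δ (fun n ↦ Φ n ω) N} := by
  set A := {ω | ConfidenceEllipsoid.weightedNorm
            (ConfidenceEllipsoid.gram Sig lam (fun n ↦ Φ n ω) N)
            (ConfidenceEllipsoid.rlsEstimator Sig lam (fun n ↦ Φ n ω) (fun n ↦ y n ω) N - θ) ≤
          ConfidenceEllipsoid.radius Sig lam S δ (fun n ↦ Φ n ω) N}
  have hA : μ Aᶜ ≤ ENNReal.ofReal δ := by
    refine (measure_mono fun ω hω ↦ ?_).trans
      (ConfidenceEllipsoid.measure_lt_exp_noiseScore_le hSig hlam ℱ hΦ hη hsub hδ N)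
    by_contra hlt
    exact hω (ConfidenceEllipsoid.weightedNorm_rlsEstimator_sub_le hSig hlam hδ hθ
      (fun n ↦ hy n ω) (not_lt.1 hlt))
  -- Subadditivity suffices here, so measurability of `A` need not be established.
  have hcover : 1 ≤ μ A + μ Aᶜ := by
    rw [← measure_univ (μ := μ), ← Set.union_compl_self A]
    exact measure_union_le _ _
  rw [ENNReal.ofReal_sub _ hδ.le, ENNReal.ofReal_one]
  exact tsub_le_iff_right.2 (hcover.trans (by gcongr))
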